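/- Let $d\ge 2$ and $0\le m\le d$ be integers and let $\mathcal H^m$ denote $m$-dimensional Hausdorff measure on $\mathbb R^d$. Let $E\subset\mathbb R^d$ be a closed set such that: (i) $E$ is $m$-rectifiable, i.e. there are countably many sets $A_i\subset\mathbb R^m$ and Lipschitz maps $f_i:A_i\to\mathbb R^d$ with $\mathcal H^m\bigl(E\setminus\bigcup_i f_i(A_i)\bigr)=0$; (ii) $E$ is weakly lower Ahlfors–David $m$-regular, i.e. for $\mathcal H^m$-a.e. $x\in E$ there is $\rho_x>0$ such that $$\inf\left\{\frac{\mathcal H^m(E\cap B(y,r))}{r^m} : y\in E\cap B(x,\rho_x),\ 0<r<\rho_x\right\}>0,$$ where $B(y,r)$ is the open ball of center $y$ and radius $r$; (iii) the restriction $\mathcal H^m|_E$ is locally finite. Then there exist a countable collection $\{\Gamma_j\}_{j\ge1}$ of $m$-dimensional Lipschitz graphs and a set $F$ with $\mathcal H^m(F)=0$ such that $$E=\bigcup_{j\ge1}\Gamma_j\cup F.$$ Here an $m$-dimensional Lipschitz graph is a set of the form $\{a+\varphi(a):a\in A\}$, where $V\subset\mathbb R^d$ is an $m$-dimensional linear subspace,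 $\varphi:V\to V^\perp$ is Lipschitz, and $A\subset V$ is an arbitrary (possibly empty) subset. -/

import Mathlib

open MeasureTheory

/-- Weak lower Ahlfors-David `m`-regularity of `E ⊆ ℝᵈ`: for `ℋᵐ`-almost every `x ∈ E` there is
`ρ > 0` such that the infimum of `ℋᵐ (E ∩ B(y, r)) / rᵐ`, over all `y ∈ E ∩ B(x, ρ)` and all
`0 < r < ρ`, is positive. -/
def IsWeaklyLowerADRegular {d : ℕ} (m : ℕ) (E : Set (EuclideanSpace ℝ (Fin d))) : Prop :=
  ∀ᵐ x ∂((μH[(m : ℝ)] : Measure (EuclideanSpace ℝ (Fin d))).restrict E),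
    ∃ ρ : ℝ, 0 < ρ ∧
      0 < ⨅ y ∈ E ∩ Metric.ball x ρ, ⨅ r ∈ Set.Ioo (0 : ℝ) ρ,
        μH[(m : ℝ)] (E ∩ Metric.ball y r) / ENNReal.ofReal r ^ m

/-- `m`-rectifiability of a (Borel) set `E ⊆ ℝᵈ`: up to an `ℋᵐ`-null set, `E` is covered by
countably many Lipschitz images of subsets of `ℝᵐ`. -/
def IsRectifiable {d : ℕ} (m : ℕ) (E : Set (EuclideanSpace ℝ (Fin d))) : Prop :=
  ∃ (A : ℕ → Set (EuclideanSpace ℝ (Fin m)))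
    (f : ℕ → EuclideanSpace ℝ (Fin m) → EuclideanSpace ℝ (Fin d)),
    (∀ i, ∃ K : NNReal, LipschitzOnWith K (f i) (A i)) ∧
      μH[(m : ℝ)] (E \ ⋃ i, f i '' A i) = 0

/-- `Γ ⊆ ℝᵈ` is an `m`-dimensional Lipschitz graph: for some `m`-dimensional linear subspace `V`,
some Lipschitz map `φ : V → Vᗮ` and some `A ⊆ V`, it is the part `{a + φ a | a ∈ A}` of the graph
of `φ` that lies over `A`. -/
def IsLipschitzGraph {d : ℕ} (m : ℕ) (Γ : Set (EuclideanSpace ℝ (Fin d))) : Prop :=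
  ∃ V : Submodule ℝ (EuclideanSpace ℝ (Fin d)), Module.finrank ℝ V = m ∧
    ∃ (A : Set V) (φ : V → Vᗮ) (K : NNReal), LipschitzWith K φ ∧
      Γ = (fun a : V => (a : EuclideanSpace ℝ (Fin d)) + (φ a : EuclideanSpace ℝ (Fin d))) '' A

open Measure Module Set
open scoped NNReal ENNReal

/-! Extend each parametrization to a Lipschitz map `f` on all of `ℝᵐ`. By Rademacher's theorem the
non-differentiability points form a null set, whose image is null. The points with non-injective
differential also have null image (a Sard-type lemma,
`LipschitzWith.hausdorffMeasure_image_not_injective_fderiv`). The remaining points split into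
countably many pieces on which `f` is close to a fixed injective linear map, and each piece has a
Lipschitz graph as image (`ApproximatesLinearOn.isLipschitzGraph_image`). -/

/-- If `f` is Lipschitz relative to the pseudometric induced by `T` on `s`, then on `s` it factors
through `T` by a Lipschitz map. -/
theorem exists_lipschitzOnWith_image_comp_eqOn {α β γ : Type*} [Nonempty α]
    [PseudoMetricSpace β] [MetricSpace γ] {f : α → γ} {T : α → β} {s : Set α} {C : ℝ≥0}
    (h : ∀ x ∈ s, ∀ y ∈ s, dist (f x) (f y) ≤ C * dist (T x) (T y)) :
    ∃ g : β → γ, LipschitzOnWith C g (T '' s) ∧ EqOn (g ∘ T) f s := by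
  refine ⟨f ∘ Function.invFunOn T s, LipschitzOnWith.of_dist_le_mul ?_, fun x hx => ?_⟩
  · rintro _ hu _ hv
    have := h _ (Function.invFunOn_mem hu) _ (Function.invFunOn_mem hv)
    rwa [Function.invFunOn_eq hu, Function.invFunOn_eq hv] at this
  · have hu : T x ∈ T '' s := mem_image_of_mem T hx
    have := h _ (Function.invFunOn_mem hu) _ hx
    rw [Function.invFunOn_eq hu, dist_self, mul_zero] at this
    exact dist_le_zero.1 this

theorem isLipschitzGraph_empty {d m : ℕ} (hm : m ≤ d) :
    IsLipschitzGraph m (∅ : Set (EuclideanSpace ℝ (Fin d))) := by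
  have hb := ((EuclideanSpace.basisFun (Fin d) ℝ).orthonormal.comp _
    (Fin.castLE_injective hm)).linearIndependent
  exact ⟨_, (finrank_span_eq_card hb).trans (Fintype.card_fin m), ∅, 0, 0,
    LipschitzWith.const' 0, (image_empty _).symm⟩

theorem IsLipschitzGraph.inter {d m : ℕ} {Γ : Set (EuclideanSpace ℝ (Fin d))}
    (h : IsLipschitzGraph m Γ) (E : Set (EuclideanSpace ℝ (Fin d))) :
    IsLipschitzGraph m (Γ ∩ E) := by
  obtain ⟨V, hV, A, φ, K, hφ, rfl⟩ := h
  exact ⟨V, hV, _, φ, K, hφ, (image_inter_preimage _ A E).symm⟩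

/-- The image of a set on which `f` is well approximated by an injective linear map is a
Lipschitz graph over the range of that map. -/
theorem ApproximatesLinearOn.isLipschitzGraph_image {d m : ℕ}
    {f : EuclideanSpace ℝ (Fin m) → EuclideanSpace ℝ (Fin d)}
    {A : EuclideanSpace ℝ (Fin m) →L[ℝ] EuclideanSpace ℝ (Fin d)}
    {s : Set (EuclideanSpace ℝ (Fin m))} {K δ : ℝ≥0} (hA : AntilipschitzWith K A)
    (hδ : K * δ < 1) (h : ApproximatesLinearOn f A s δ) : IsLipschitzGraph m (f '' s) := by
  set V : Submodule ℝ (EuclideanSpace ℝ (Fin d)) := LinearMap.range A.toLinearMap with hV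
  have hpos : (0 : ℝ) < 1 - K * δ := sub_pos.2 (by exact_mod_cast hδ)
  have key : ∀ x ∈ s, ∀ y ∈ s,
      dist (Vᗮ.orthogonalProjectionOnto (f x)) (Vᗮ.orthogonalProjectionOnto (f y)) ≤
        (δ * (K / (1 - K * δ) : ℝ).toNNReal : ℝ≥0) *
          dist (V.orthogonalProjectionOnto (f x)) (V.orthogonalProjectionOnto (f y)) := by
    intro x hx y hy
    have hxy := h x hx y hy
    have hAV : A (x - y) ∈ V := LinearMap.mem_range_self _ _
    have hlow : ‖x - y‖ ≤ K * ‖A (x - y)‖ := by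
      simpa using hA.le_mul_dist (x - y) 0
    set e := f x - f y - A (x - y) with he
    have hsub : f x - f y = A (x - y) + e := by rw [he]; abel
    -- `Vᗮ` sees only the error `e`, while `V` sees `A (x - y)` up to `e`. Since `K * δ < 1`, the
    -- error can be absorbed in `h5`.
    have h1 : ‖Vᗮ.orthogonalProjectionOnto (f x - f y)‖ ≤ δ * ‖x - y‖ := by
      have : Vᗮ.orthogonalProjectionOnto (A (x - y)) = 0 :=
        Submodule.orthogonalProjectionOnto_eq_zero_iff.2
          (Submodule.le_orthogonal_orthogonal V hAV)
      rw [hsub, map_add, this, zero_add]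
      exact (Vᗮ.norm_orthogonalProjectionOnto_apply_le e).trans hxy
    have h2 : ‖A (x - y)‖ ≤ ‖V.orthogonalProjectionOnto (f x - f y)‖ + δ * ‖x - y‖ := by
      have h3 : V.orthogonalProjectionOnto (f x - f y) =
          ⟨A (x - y), hAV⟩ + V.orthogonalProjectionOnto e := by
        rw [hsub, map_add]
        congr 1
        exact V.orthogonalProjectionOnto_mem_subspace_eq_self ⟨A (x - y), hAV⟩
      have h4 : ‖A (x - y)‖ = ‖V.orthogonalProjectionOnto (f x - f y)
          - V.orthogonalProjectionOnto e‖ := by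
        rw [h3, add_sub_cancel_right]; rfl
      rw [h4]
      exact (norm_sub_le _ _).trans
        (add_le_add_right ((V.norm_orthogonalProjectionOnto_apply_le e).trans hxy) _)
    have h5 : ‖x - y‖ ≤ K / (1 - K * δ) * ‖V.orthogonalProjectionOnto (f x - f y)‖ := by
      rw [div_mul_eq_mul_div, le_div_iff₀ hpos]
      nlinarith [mul_le_mul_of_nonneg_left h2 K.coe_nonneg]
    rw [dist_eq_norm, dist_eq_norm, ← map_sub, ← map_sub, NNReal.coe_mul,
      Real.coe_toNNReal _ (by positivity), mul_assoc]
    exact h1.trans (mul_le_mul_of_nonneg_left h5 δ.coe_nonneg)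
  obtain ⟨g, hg, hgf⟩ := exists_lipschitzOnWith_image_comp_eqOn
    (f := fun x => Vᗮ.orthogonalProjectionOnto (f x))
    (T := fun x => V.orthogonalProjectionOnto (f x)) key
  obtain ⟨φ, hφ, hφg⟩ := hg.extend_finite_dimension
  refine ⟨V, ?_, (fun x => V.orthogonalProjectionOnto (f x)) '' s, φ, _, hφ, ?_⟩
  · rw [hV, LinearMap.finrank_range_of_inj hA.injective, finrank_euclideanSpace_fin]
  · rw [image_image]
    refine image_congr fun x hx => ?_
    have : φ (V.orthogonalProjectionOnto (f x)) = Vᗮ.orthogonalProjectionOnto (f x) :=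
      (hφg (mem_image_of_mem _ hx)).symm.trans (hgf hx)
    rw [this]
    exact (V.starProjection_add_starProjection_orthogonal (f x)).symm

section Critical

variable {E F : Type*} [NormedAddCommGroup E] [InnerProductSpace ℝ E] [FiniteDimensional ℝ E]
  [MeasurableSpace E] [BorelSpace E] [NormedAddCommGroup F] [NormedSpace ℝ F]
  [MeasurableSpace F] [BorelSpace F]

/-- The image of a set on which `f` is `η`-close to a linear map with nontrivial kernel has
Hausdorff measure at most a multiple of `η` times the measure of the set. -/
theorem ApproximatesLinearOn.hausdorffMeasure_image_le_of_not_injective {f : E → F}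
    {A : E →L[ℝ] F} {s : Set E} {C η : ℝ≥0} (hη : 0 < η) (hη1 : η ≤ 1) (hAC : ‖A‖ ≤ C)
    (hA : ¬ Function.Injective A) (h : ApproximatesLinearOn f A s η) :
    μH[finrank ℝ E] (f '' s) ≤ (C + 1 : ℝ≥0) ^ finrank ℝ E * (η * μH[finrank ℝ E] s) := by
  obtain ⟨v, hv1, hAv⟩ : ∃ v : E, ‖v‖ = 1 ∧ A v = 0 := by
    rw [injective_iff_map_eq_zero] at hA
    push Not at hA
    obtain ⟨w, hAw, hw⟩ := hA
    exact ⟨‖w‖⁻¹ • w, norm_smul_inv_norm (𝕜 := ℝ) hw, by simp [hAw]⟩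
  have hη0 : (0 : ℝ) < η := hη
  have hη1' : (η : ℝ) ≤ 1 := hη1
  -- `T` shrinks the kernel direction `v` by `η` and fixes its orthogonal complement. Thus `A ∘ T =
  -- A`, and `f` factors through `T` on `s` with constant `C + 1`, while `T` scales measure by `η`.
  set T : E →ₗ[ℝ] E := LinearMap.transvection (innerSL ℝ v).toLinearMap (((η : ℝ) - 1) • v)
    with hT
  have hTw : ∀ w, T w = w + inner ℝ v w • ((η : ℝ) - 1) • v := fun w => rfl
  have hdet : LinearMap.det T = η := by
    rw [hT, LinearMap.transvection.det]
    simp [hv1]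
  have hAT : ∀ w, A (T w) = A w := fun w => by simp [hTw, hAv]
  have hnorm : ∀ w, η * ‖w‖ ≤ ‖T w‖ := fun w => by
    have h1 : inner ℝ v (T w) = η * inner ℝ v w := by
      rw [hTw, inner_add_right, inner_smul_right, inner_smul_right, real_inner_self_eq_norm_sq,
        hv1]
      ring
    have h2 : η * |inner ℝ v w| ≤ ‖T w‖ := by
      have := abs_real_inner_le_norm v (T w)
      rwa [h1, hv1, one_mul, abs_mul, abs_of_pos hη0] at this
    have h3 : ‖w‖ ≤ ‖T w‖ + |inner ℝ v w| * (1 - η) := by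
      have : w = T w - inner ℝ v w • ((η : ℝ) - 1) • v := by rw [hTw]; abel
      calc ‖w‖ = ‖T w - inner ℝ v w • ((η : ℝ) - 1) • v‖ := by rw [← this]
        _ ≤ _ := norm_sub_le _ _
        _ = _ := by
          rw [norm_smul, norm_smul, hv1, mul_one, Real.norm_eq_abs, Real.norm_eq_abs,
            abs_sub_comm, abs_of_nonneg (sub_nonneg.2 hη1')]
    -- Add `η` times `h3` to `1 - η` times `h2`.
    nlinarith [mul_le_mul_of_nonneg_left h3 hη0.le,
      mul_le_mul_of_nonneg_left h2 (sub_nonneg.2 hη1')]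
  have key : ∀ x ∈ s, ∀ y ∈ s, dist (f x) (f y) ≤ (C + 1 : ℝ≥0) * dist (T x) (T y) := by
    intro x hx y hy
    rw [dist_eq_norm, dist_eq_norm, ← map_sub]
    calc ‖f x - f y‖ = ‖A (T (x - y)) + (f x - f y - A (x - y))‖ := by rw [hAT]; congr 1; abel
      _ ≤ ‖A (T (x - y))‖ + ‖f x - f y - A (x - y)‖ := norm_add_le _ _
      _ ≤ C * ‖T (x - y)‖ + ‖T (x - y)‖ :=
        add_le_add (A.le_of_opNorm_le hAC _) ((h x hx y hy).trans (hnorm _))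
      _ = (C + 1 : ℝ≥0) * ‖T (x - y)‖ := by push_cast; ring
  obtain ⟨g, hg, hgf⟩ := exists_lipschitzOnWith_image_comp_eqOn key
  rw [← hgf.image_eq, image_comp]
  refine (hg.hausdorffMeasure_image_le (Nat.cast_nonneg _)).trans ?_
  rw [addHaar_image_linearMap, hdet, abs_of_pos hη0, ENNReal.ofReal_coe_nnreal,
    ENNReal.rpow_natCast]

/-- The set of critical values of a Lipschitz map is null for the Hausdorff measure of the
dimension of the source. -/
theorem LipschitzWith.hausdorffMeasure_image_not_injective_fderiv {f : E → F} {C : ℝ≥0}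
    [SecondCountableTopology F] (hf : LipschitzWith C f) :
    μH[finrank ℝ E] (f '' {x | DifferentiableAt ℝ f x ∧ ¬ Function.Injective (fderiv ℝ f x)})
      = 0 := by
  set S := {x | DifferentiableAt ℝ f x ∧ ¬ Function.Injective (fderiv ℝ f x)} with hS
  set n := finrank ℝ E
  -- Balls have finite measure, so a bound proportional to `η` vanishes as `η → 0`.
  have hball : ∀ R : ℕ, μH[n] (f '' (S ∩ Metric.ball 0 R)) = 0 := by
    intro R
    set B := S ∩ Metric.ball 0 (R : ℝ) with hB
    have hbound : ∀ η : ℝ≥0, 0 < η → η ≤ 1 →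
        μH[n] (f '' B) ≤ η * ((C + 1 : ℝ≥0) ^ n * μH[n] (Metric.ball (0 : E) R)) := by
      intro η hη hη1
      rcases B.eq_empty_or_nonempty with hB0 | hBne
      · simp [hB0]
      obtain ⟨t, A, htd, htm, hcov, happ, hmem⟩ :=
        exists_partition_approximatesLinearOn_of_hasFDerivWithinAt f B (fderiv ℝ f)
          (fun x hx => hx.1.1.hasFDerivAt.hasFDerivWithinAt) (fun _ => η) (fun _ => hη.ne')
      -- Enlarging `B ∩ t k` to `ball ∩ t k` gives disjoint measurable sets, whose measures sum
      -- without measurability of `B`.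
      have hpiece : ∀ k, μH[n] (f '' (B ∩ t k)) ≤
          (C + 1 : ℝ≥0) ^ n * (η * μH[n] (Metric.ball (0 : E) R ∩ t k)) := by
        intro k
        obtain ⟨y, hy, hAy⟩ := hmem hBne k
        refine ((happ k).hausdorffMeasure_image_le_of_not_injective (C := C) hη hη1 ?_ ?_).trans ?_
        · rw [hAy]; exact norm_fderiv_le_of_lipschitz ℝ hf
        · rw [hAy]; exact hy.1.2
        · gcongr
          exact inter_subset_right
      calc μH[n] (f '' B) ≤ μH[n] (⋃ k, f '' (B ∩ t k)) := by
            rw [← image_iUnion, ← inter_iUnion, inter_eq_self_of_subset_left hcov]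
        _ ≤ ∑' k, μH[n] (f '' (B ∩ t k)) := measure_iUnion_le _
        _ ≤ ∑' k, (C + 1 : ℝ≥0) ^ n * (η * μH[n] (Metric.ball (0 : E) R ∩ t k)) :=
          ENNReal.tsum_le_tsum hpiece
        _ = (C + 1 : ℝ≥0) ^ n * (η * μH[n] (⋃ k, Metric.ball (0 : E) R ∩ t k)) := by
          rw [ENNReal.tsum_mul_left, ENNReal.tsum_mul_left, measure_iUnion
            (fun i j hij => (htd hij).mono inter_subset_right inter_subset_right)
            (fun k => measurableSet_ball.inter (htm k))]
        _ ≤ (C + 1 : ℝ≥0) ^ n * (η * μH[n] (Metric.ball (0 : E) R)) := by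
          gcongr
          exact iUnion_subset fun _ => inter_subset_left
        _ = _ := by ring
    have hM : (C + 1 : ℝ≥0) ^ n * μH[n] (Metric.ball (0 : E) R) ≠ ∞ :=
      ENNReal.mul_ne_top (ENNReal.pow_ne_top ENNReal.coe_ne_top) measure_ball_lt_top.ne
    have hlim : Filter.Tendsto (fun η : ℝ≥0 => (η : ℝ≥0∞) *
        ((C + 1 : ℝ≥0) ^ n * μH[n] (Metric.ball (0 : E) R))) (nhdsWithin 0 (Ioi 0))
        (nhds 0) := by
      have h0 : Filter.Tendsto (fun η : ℝ≥0 => (η : ℝ≥0∞)) (nhdsWithin 0 (Ioi 0)) (nhds 0) :=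
        (ENNReal.continuous_coe.tendsto' 0 0 rfl).mono_left nhdsWithin_le_nhds
      simpa using ENNReal.Tendsto.mul_const h0 (Or.inr hM)
    refine le_antisymm (ge_of_tendsto hlim ?_) bot_le
    filter_upwards [Ioc_mem_nhdsGT (zero_lt_one' ℝ≥0)] with η hη using hbound η hη.1 hη.2
  have hSU : S = ⋃ R : ℕ, S ∩ Metric.ball 0 (R : ℝ) := by
    rw [← inter_iUnion, Metric.iUnion_ball_nat, inter_univ]
  rw [hSU, image_iUnion]
  exact measure_iUnion_null hball

end Critical

/-- The range of a Lipschitz map is almost covered by countably many Lipschitz graphs. -/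
theorem LipschitzWith.exists_isLipschitzGraph_cover_range {d m : ℕ} {C : ℝ≥0}
    {f : EuclideanSpace ℝ (Fin m) → EuclideanSpace ℝ (Fin d)} (hf : LipschitzWith C f)
    (hm : m ≤ d) :
    ∃ Γ : ℕ → Set (EuclideanSpace ℝ (Fin d)), (∀ j, IsLipschitzGraph m (Γ j)) ∧
      μH[(m : ℝ)] (range f \ ⋃ j, Γ j) = 0 := by
  set S := {x | DifferentiableAt ℝ f x ∧ ¬ Function.Injective (fderiv ℝ f x)} with hS
  set N := {x | ¬ DifferentiableAt ℝ f x} with hN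
  set G := {x | DifferentiableAt ℝ f x ∧ Function.Injective (fderiv ℝ f x)} with hG
  have hfin : finrank ℝ (EuclideanSpace ℝ (Fin m)) = m := finrank_euclideanSpace_fin
  have hSnull : μH[(m : ℝ)] (f '' S) = 0 := by
    simpa only [hfin] using hf.hausdorffMeasure_image_not_injective_fderiv
  have hNnull : μH[(m : ℝ)] (f '' N) = 0 := by
    have h0 : μH[(finrank ℝ (EuclideanSpace ℝ (Fin m)) : ℝ)] N = 0 :=
      ae_iff.1 hf.ae_differentiableAt
    rw [hfin] at h0
    refine le_antisymm ((hf.hausdorffMeasure_image_le (Nat.cast_nonneg m) N).trans ?_) bot_le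
    rw [h0, mul_zero]
  have hanti : ∀ A : EuclideanSpace ℝ (Fin m) →L[ℝ] EuclideanSpace ℝ (Fin d),
      Function.Injective A → ∃ K > 0, AntilipschitzWith K A := fun A hA =>
    A.toLinearMap.exists_antilipschitzWith (LinearMap.ker_eq_bot.2 hA)
  have hradius : ∀ A : EuclideanSpace ℝ (Fin m) →L[ℝ] EuclideanSpace ℝ (Fin d),
      ∃ δ : ℝ≥0, δ ≠ 0 ∧ (Function.Injective A → ∃ K : ℝ≥0, AntilipschitzWith K A ∧ K * δ < 1) := by
    intro A
    by_cases hA : Function.Injective A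
    · obtain ⟨K, hK, hKA⟩ := hanti A hA
      refine ⟨K⁻¹ / 2, by positivity, fun _ => ⟨K, hKA, ?_⟩⟩
      rw [← mul_div_assoc, mul_inv_cancel₀ hK.ne']
      exact NNReal.half_lt_self one_ne_zero
    -- The radius must be nonzero at every linear map; 1 is a dummy value.
    · exact ⟨1, one_ne_zero, fun h => absurd h hA⟩
  choose r hr0 hr using hradius
  obtain ⟨t, A, -, -, hcov, happ, hmem⟩ :=
    exists_partition_approximatesLinearOn_of_hasFDerivWithinAt f G (fderiv ℝ f)
      (fun x hx => hx.1.hasFDerivAt.hasFDerivWithinAt) r hr0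
  have hcover : range f \ ⋃ j, f '' (G ∩ t j) ⊆ f '' S ∪ f '' N := by
    rintro _ ⟨⟨x, rfl⟩, hx⟩
    rw [← image_iUnion, ← inter_iUnion, inter_eq_self_of_subset_left hcov] at hx
    by_cases hd : DifferentiableAt ℝ f x
    · exact Or.inl ⟨x, ⟨hd, fun hi => hx ⟨x, ⟨hd, hi⟩, rfl⟩⟩, rfl⟩
    · exact Or.inr ⟨x, hd, rfl⟩
  refine ⟨fun j => f '' (G ∩ t j), fun j => ?_,
    measure_mono_null hcover (measure_union_null hSnull hNnull)⟩
  -- If `G` is empty, nothing is known about `A j`, so the empty graph is supplied separately.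
  rcases G.eq_empty_or_nonempty with hG0 | hGne
  · simpa [hG0] using isLipschitzGraph_empty hm
  obtain ⟨y, hy, hAy⟩ := hmem hGne j
  obtain ⟨K, hK, hKr⟩ := hr (A j) (hAy ▸ hy.2)
  exact (happ j).isLipschitzGraph_image hK hKr

theorem mainTheorem2 (d m : ℕ) (hd : 2 ≤ d) (hm : m ≤ d)
    (E : Set (EuclideanSpace ℝ (Fin d))) (hE : IsClosed E)
    (hrect : IsRectifiable m E) (hreg : IsWeaklyLowerADRegular m E)
    (hfin : IsLocallyFiniteMeasure
      ((μH[(m : ℝ)] : Measure (EuclideanSpace ℝ (Fin d))).restrict E)) :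
    ∃ (Γ : ℕ → Set (EuclideanSpace ℝ (Fin d))) (F : Set (EuclideanSpace ℝ (Fin d))),
      (∀ j, IsLipschitzGraph m (Γ j)) ∧ μH[(m : ℝ)] F = 0 ∧ E = (⋃ j, Γ j) ∪ F := by
  obtain ⟨A, f, hlip, hnull⟩ := hrect
  have hcov : ∀ i, ∃ Γ : ℕ → Set (EuclideanSpace ℝ (Fin d)),
      (∀ j, IsLipschitzGraph m (Γ j)) ∧ μH[(m : ℝ)] (f i '' A i \ ⋃ j, Γ j) = 0 := by
    intro i
    obtain ⟨K, hK⟩ := hlip i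
    obtain ⟨g, hg, hgf⟩ := hK.extend_finite_dimension
    obtain ⟨Γ, hΓ, hΓ0⟩ := hg.exists_isLipschitzGraph_cover_range hm
    refine ⟨Γ, hΓ, measure_mono_null (sdiff_subset_sdiff_left ?_) hΓ0⟩
    rw [hgf.image_eq]
    exact image_subset_range _ _
  choose Γ hΓ hΓ0 using hcov
  have hpair : (⋃ j : ℕ, Γ j.unpair.1 j.unpair.2) = ⋃ i, ⋃ j, Γ i j := iUnion_unpair Γ
  -- Graphs over arbitrary subsets stay graphs when cut by `E`, which turns the almost-cover into an
  -- exact equality.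
  refine ⟨fun j => Γ j.unpair.1 j.unpair.2 ∩ E, E \ ⋃ i, ⋃ j, Γ i j,
    fun j => (hΓ _ _).inter E, ?_, ?_⟩
  · refine measure_mono_null (t := (E \ ⋃ i, f i '' A i) ∪ ⋃ i, (f i '' A i \ ⋃ j, Γ i j)) ?_
      (measure_union_null hnull (measure_iUnion_null hΓ0))
    rintro x ⟨hxE, hx⟩
    by_cases hxA : x ∈ ⋃ i, f i '' A i
    · obtain ⟨i, hi⟩ := mem_iUnion.1 hxA
      exact Or.inr (mem_iUnion.2 ⟨i, hi, fun h => hx (mem_iUnion.2 ⟨i, h⟩)⟩)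
    · exact Or.inl ⟨hxE, hxA⟩
  · rw [← iUnion_inter, hpair, inter_comm, inter_union_sdiff]
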